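/- Let $P\subset\mathbb{R}^3$ be a tetrahedron, that is, the convex hull of four affinely independent points. Let $S(P)$ denote its surface area and $V(P)$ its volume. Then $$\frac{S(P)^3}{V(P)^2}\ \geq\ 216\sqrt{3},$$ and equality holds if and only if $P$ is a regular tetrahedron. -/

import Mathlib

open MeasureTheory

/-- The surface area `S(K)` of a body `K` in `ℝ³`: the two-dimensional Hausdorff measure of its
boundary, normalized to agree with Lebesgue measure on Euclidean planes. -/
noncomputable def surfaceArea (K : Set (EuclideanSpace ℝ (Fin 3))) : ℝ :=
  (Measure.euclideanHausdorffMeasure 2 (frontier K)).toReal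

/-- The volume `V(K)` of a body `K` in `ℝ³`. -/
noncomputable def bodyVolume (K : Set (EuclideanSpace ℝ (Fin 3))) : ℝ :=
  (volume K).toReal

/-- The solid tetrahedron `P` with four given vertices: their convex hull. An
`Affine.Simplex ℝ (EuclideanSpace ℝ (Fin 3)) 3` is a family of four affinely independent points,
so the hull has nonempty interior. -/
def solidTetrahedron (T : Affine.Simplex ℝ (EuclideanSpace ℝ (Fin 3)) 3) :
    Set (EuclideanSpace ℝ (Fin 3)) :=
  convexHull ℝ (Set.range T.points)

/-! Let `a`, `b`, `c` be the edge vectors at one vertex and `d` their triple product, so V = |d|/6.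
The cross products x = b×c, y = c×a, z = a×b and x+y+z are, up to sign, facet normals whose lengths
sᵢ are twice the facet areas, so σ = ∑ sᵢ = 2S.

The positive semidefinite matrix M = ∑ nᵢnᵢᵀ/sᵢ, over these four normals nᵢ, has trace σ and
determinant d⁴σ/π with π = ∏ sᵢ. AM-GM on its eigenvalues gives 27d⁴ ≤ σ²π, and AM-GM on the sᵢ
gives π ≤ (σ/4)⁴. Together they give 6912d⁴ ≤ σ⁶ (`triple_product_pow_le`), the squared form of the
claim.

At equality M is scalar and the sᵢ agree. Each edge is orthogonal to two normals and pairs to ±d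
with the other two, so evaluating M on the edges shows that all six have the same length;
`Affine.Simplex.Equilateral.regular` then supplies the symmetries. The measures become Gram
determinants through `euclideanHausdorffMeasure_convexHull_range`. -/

/-! ### Measure of a simplex -/

/-- The corner simplex `{x ≥ 0, ∑ xᵢ ≤ r}` in `ℝⁿ`. -/
def cornerSimplex (n : ℕ) (r : ℝ) : Set (Fin n → ℝ) :=
  {x | (∀ i, 0 ≤ x i) ∧ ∑ i, x i ≤ r}

theorem isClosed_cornerSimplex (n : ℕ) (r : ℝ) : IsClosed (cornerSimplex n r) := by
  have h : cornerSimplex n r = (⋂ i, {x | 0 ≤ x i}) ∩ {x | ∑ i, x i ≤ r} := by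
    ext x; simp [cornerSimplex]
  rw [h]
  refine (isClosed_iInter fun i => isClosed_le ?_ ?_).inter (isClosed_le ?_ ?_) <;> fun_prop

theorem convex_cornerSimplex (n : ℕ) (r : ℝ) : Convex ℝ (cornerSimplex n r) := by
  rintro x ⟨hx, hx'⟩ y ⟨hy, hy'⟩ s t hs ht hst
  refine ⟨fun i => ?_, ?_⟩
  · have := mul_nonneg hs (hx i)
    have := mul_nonneg ht (hy i)
    simpa using by linarith
  · simp only [Pi.add_apply, Pi.smul_apply, smul_eq_mul, Finset.sum_add_distrib, ← Finset.mul_sum]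
    calc s * ∑ i, x i + t * ∑ i, y i ≤ s * r + t * r := by gcongr
      _ = r := by rw [← add_mul, hst, one_mul]

theorem volume_cornerSimplex (n : ℕ) {r : ℝ} (hr : 0 ≤ r) :
    volume (cornerSimplex n r) = ENNReal.ofReal (r ^ n / n.factorial) := by
  induction n generalizing r with
  | zero =>
    have : cornerSimplex 0 r = Set.univ := by ext x; simp [cornerSimplex, hr]
    simp [this, volume_pi]
  | succ n ih =>
    have hmp := (volume_preserving_piFinSuccAbove (fun _ : Fin (n + 1) => ℝ) 0).symm
    rw [← hmp.measure_preimage_equiv, Measure.volume_eq_prod,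
      Measure.prod_apply ((isClosed_cornerSimplex _ _).measurableSet.preimage
        (MeasurableEquiv.measurable _))]
    -- Fubini: the slice at first coordinate t is a corner simplex of size r - t, empty unless 0 ≤ t
    -- ≤ r.
    have hslice (t : ℝ) : volume (Prod.mk t ⁻¹' ((MeasurableEquiv.piFinSuccAbove
        (fun _ : Fin (n + 1) => ℝ) 0).symm ⁻¹' cornerSimplex (n + 1) r)) =
        (Set.Icc 0 r).indicator (fun t => ENNReal.ofReal ((r - t) ^ n / n.factorial)) t := by
      have hset : Prod.mk t ⁻¹' ((MeasurableEquiv.piFinSuccAbove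
          (fun _ : Fin (n + 1) => ℝ) 0).symm ⁻¹' cornerSimplex (n + 1) r) =
          {y | 0 ≤ t ∧ y ∈ cornerSimplex n (r - t)} := by
        ext y
        simp [cornerSimplex, MeasurableEquiv.piFinSuccAbove, Fin.forall_fin_succ, Fin.sum_univ_succ,
          and_assoc, le_sub_iff_add_le']
      rw [hset]
      by_cases ht : t ∈ Set.Icc 0 r
      · rw [Set.indicator_of_mem ht, ← ih (sub_nonneg.2 ht.2)]
        simp [ht.1]
      · rw [Set.indicator_of_notMem ht]
        convert measure_empty (μ := volume)
        refine Set.eq_empty_of_forall_notMem fun y hy => ht ⟨hy.1, ?_⟩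
        have := (Finset.sum_nonneg fun i _ => hy.2.1 i).trans hy.2.2
        linarith
    simp_rw [hslice]
    rw [lintegral_indicator measurableSet_Icc, ← ofReal_integral_eq_lintegral_ofReal]
    · congr 1
      rw [integral_Icc_eq_integral_Ioc, ← intervalIntegral.integral_of_le hr,
        intervalIntegral.integral_div,
        intervalIntegral.integral_comp_sub_left (fun t => t ^ n) r]
      simp [integral_pow, Nat.factorial_succ, div_div, mul_comm]
    · exact (by fun_prop : Continuous fun t : ℝ => (r - t) ^ n / n.factorial).continuousOn.integrableOn_Icc
    · filter_upwards [ae_restrict_mem measurableSet_Icc] with t ht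
      have := sub_nonneg.2 ht.2
      positivity

theorem convexHull_range_eq_image_cornerSimplex {E : Type*} [AddCommGroup E] [Module ℝ E] {n : ℕ}
    (q : Fin (n + 1) → E) :
    convexHull ℝ (Set.range q) =
      (fun x : Fin n → ℝ => (∑ i, x i • (q i.succ - q 0)) + q 0) '' cornerSimplex n 1 := by
  apply Set.Subset.antisymm
  · refine convexHull_min ?_ ?_
    · rintro _ ⟨i, rfl⟩
      refine Fin.cases ⟨0, by simp [cornerSimplex], by simp⟩ (fun i => ?_) i
      refine ⟨Pi.single i 1, ⟨fun j => ?_, by simp⟩, ?_⟩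
      · by_cases h : j = i <;> simp [h]
      · simp [Pi.single_apply, ite_smul]
    · rintro _ ⟨x, hx, rfl⟩ _ ⟨y, hy, rfl⟩ s t hs ht hst
      refine ⟨s • x + t • y, convex_cornerSimplex n 1 hx hy hs ht hst, ?_⟩
      simp only [Pi.add_apply, Pi.smul_apply, smul_eq_mul, add_smul, mul_smul,
        Finset.sum_add_distrib, ← Finset.smul_sum, smul_add]
      obtain rfl := eq_sub_of_add_eq' hst
      module
  · rintro _ ⟨x, ⟨hx, hx'⟩, rfl⟩
    have h := (convex_convexHull ℝ (Set.range q)).sum_mem (t := Finset.univ)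
      (w := Fin.cons (1 - ∑ i, x i) x) (z := q) ?_ ?_ fun i _ => subset_convexHull _ _ ⟨i, rfl⟩
    · convert h using 1
      simp only [Fin.sum_univ_succ, Fin.cons_zero, Fin.cons_succ, smul_sub, Finset.sum_sub_distrib,
        ← Finset.sum_smul]
      module
    · intro i _
      refine Fin.cases ?_ (fun i => ?_) i
      · simpa using hx'
      · simpa using hx i
    · simp [Fin.sum_univ_succ]

/-- The `n`-dimensional measure of the convex hull of `n + 1` points. -/
theorem euclideanHausdorffMeasure_convexHull_range {E : Type*} [NormedAddCommGroup E]
    [InnerProductSpace ℝ E] [MeasurableSpace E] [BorelSpace E] {n : ℕ} (q : Fin (n + 1) → E) :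
    Measure.euclideanHausdorffMeasure n (convexHull ℝ (Set.range q)) =
      ENNReal.ofReal (√(Matrix.gram ℝ fun i : Fin n => q i.succ - q 0).det / n.factorial) := by
  let f : EuclideanSpace ℝ (Fin n) →ₗ[ℝ] E :=
    (Fintype.linearCombination ℝ fun i : Fin n => q i.succ - q 0) ∘ₗ
      (WithLp.linearEquiv 2 ℝ (Fin n → ℝ)).toLinearMap
  have hf (x : EuclideanSpace ℝ (Fin n)) : f x = ∑ i, x i • (q i.succ - q 0) := by
    simp [f, Fintype.linearCombination_apply]
  have himg : convexHull ℝ (Set.range q) =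
      (IsometryEquiv.addRight (q 0)) '' (f '' (WithLp.ofLp ⁻¹' cornerSimplex n 1)) := by
    rw [convexHull_range_eq_image_cornerSimplex]
    ext y
    constructor
    · rintro ⟨x, hx, rfl⟩
      exact ⟨_, ⟨WithLp.toLp 2 x, hx, rfl⟩, by simp [hf]⟩
    · rintro ⟨_, ⟨x, hx, rfl⟩, rfl⟩
      exact ⟨WithLp.ofLp x, hx, by simp [hf]⟩
  have hdet : f.normDet = √(Matrix.gram ℝ fun i : Fin n => q i.succ - q 0).det := by
    have h := f.normDet_sq_eq_det_gram (EuclideanSpace.basisFun (Fin n) ℝ)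
    have h' : (fun i => f (EuclideanSpace.basisFun (Fin n) ℝ i)) = fun i => q i.succ - q 0 := by
      ext i; simp [hf, ite_smul]
    rw [h'] at h
    rw [← h]
    exact (Real.sqrt_sq f.normDet_nonneg).symm
  have hvol := (PiLp.volume_preserving_ofLp (Fin n)).measure_preimage
    (isClosed_cornerSimplex n 1).nullMeasurableSet
  have himage := f.euclideanHausdorffMeasure_image_eq_normDet_mul_volume
    (WithLp.ofLp ⁻¹' cornerSimplex n 1)
  rw [finrank_euclideanSpace_fin] at himage
  rw [himg, (IsometryEquiv.addRight (q 0)).isometry.euclideanHausdorffMeasure_image, himage, hvol,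
    volume_cornerSimplex n zero_le_one, hdet, ← ENNReal.ofReal_mul (Real.sqrt_nonneg _), one_pow,
    mul_one_div]

theorem gram_det_fin_two {E : Type*} [NormedAddCommGroup E] [InnerProductSpace ℝ E]
    (v : Fin 2 → E) :
    (Matrix.gram ℝ v).det = inner ℝ (v 0) (v 0) * inner ℝ (v 1) (v 1) - inner ℝ (v 0) (v 1) ^ 2 := by
  rw [Matrix.det_fin_two]
  simp only [Matrix.gram_apply, real_inner_comm (v 0) (v 1)]
  ring

/-- Segments have zero area. -/
theorem euclideanHausdorffMeasure_two_convexHull_pair {E : Type*} [NormedAddCommGroup E]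
    [InnerProductSpace ℝ E] [MeasurableSpace E] [BorelSpace E] (p q : E) :
    Measure.euclideanHausdorffMeasure 2 (convexHull ℝ {p, q}) = 0 := by
  -- A segment is a triangle with a repeated vertex, whose Gram determinant vanishes.
  have h : ({p, q} : Set E) = Set.range ![p, p, q] := by simp [Matrix.range_cons, Set.pair_comm]
  rw [h, euclideanHausdorffMeasure_convexHull_range, gram_det_fin_two]
  simp [Fin.succ_one_eq_two]

/-! ### Boundary of a simplex -/

namespace Affine.Simplex

theorem convexHull_range_succAbove {V : Type*} [AddCommGroup V] [Module ℝ V]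
    {n : ℕ} [NeZero n] (T : Simplex ℝ V n) (i : Fin (n + 1)) :
    convexHull ℝ (Set.range (T.points ∘ i.succAbove)) = (T.faceOpposite i).closedInterior := by
  rw [← convexHull_eq_closedInterior, range_faceOpposite_points, Set.range_comp,
    Fin.range_succAbove]

/-- A full-dimensional simplex, as an affine basis. -/
noncomputable def toAffineBasis {V : Type*} [NormedAddCommGroup V] [NormedSpace ℝ V]
    [FiniteDimensional ℝ V] {n : ℕ} (T : Simplex ℝ V n) (hn : Module.finrank ℝ V = n) :
    AffineBasis (Fin (n + 1)) ℝ V :=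
  ⟨T.points, T.independent,
    T.independent.affineSpan_eq_top_iff_card_eq_finrank_add_one.2 (by simp [hn])⟩

theorem coe_toAffineBasis {V : Type*} [NormedAddCommGroup V] [NormedSpace ℝ V]
    [FiniteDimensional ℝ V] {n : ℕ} (T : Simplex ℝ V n) (hn : Module.finrank ℝ V = n) :
    ⇑(T.toAffineBasis hn) = T.points := rfl

theorem interior_closedInterior {V : Type*} [NormedAddCommGroup V] [NormedSpace ℝ V]
    [FiniteDimensional ℝ V] {n : ℕ} [NeZero n] (T : Simplex ℝ V n)
    (hn : Module.finrank ℝ V = n) : _root_.interior T.closedInterior = T.interior := by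
  rw [← convexHull_eq_closedInterior, ← T.coe_toAffineBasis hn, AffineBasis.interior_convexHull]
  ext x
  set b := T.toAffineBasis hn
  have hx : Finset.univ.affineCombination ℝ T.points (fun i => b.coord i x) = x :=
    b.affineCombination_coord_eq_self x
  have hsum : ∑ i, b.coord i x = 1 := b.sum_coord_apply_eq_one x
  have key := affineCombination_mem_interior_iff (s := T) hsum
  rw [hx] at key
  rw [key, Set.mem_ofPred_eq]
  -- Since n ≠ 0 there is another positive coordinate, which forces this one below 1.
  refine ⟨fun h i => ⟨h i, ?_⟩, fun h i => (h i).1⟩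
  obtain ⟨j, hj⟩ := exists_ne i
  rw [← hsum]
  exact Finset.single_lt_sum hj (Finset.mem_univ i) (Finset.mem_univ j) (h j) fun k _ _ => (h k).le

/-- The boundary of a full-dimensional simplex is the union of its facets. -/
theorem frontier_convexHull {V : Type*} [NormedAddCommGroup V] [NormedSpace ℝ V]
    [FiniteDimensional ℝ V] {n : ℕ} [NeZero n] (T : Simplex ℝ V n)
    (hn : Module.finrank ℝ V = n) : frontier (convexHull ℝ (Set.range T.points)) =
      ⋃ i : Fin (n + 1), convexHull ℝ (Set.range (T.points ∘ i.succAbove)) := by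
  simp_rw [convexHull_range_succAbove, convexHull_eq_closedInterior]
  rw [← closedInterior_sdiff_interior, frontier, T.isClosed_closedInterior.closure_eq,
    T.interior_closedInterior hn]

/-- Makes distinct facets of a tetrahedron overlap only in an edge, so that their areas add. -/
theorem inter_convexHull_succAbove {V : Type*} [AddCommGroup V] [Module ℝ V]
    {n : ℕ} (T : Simplex ℝ V n) (i j : Fin (n + 1)) :
    convexHull ℝ (Set.range (T.points ∘ i.succAbove)) ∩
      convexHull ℝ (Set.range (T.points ∘ j.succAbove)) = convexHull ℝ (T.points '' {i, j}ᶜ) := by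
  classical
  have hs : AffineIndependent ℝ ((↑) : Finset.univ.image T.points → V) := by
    have h := T.independent.range
    rwa [← Set.image_univ, ← Finset.coe_univ, ← Finset.coe_image] at h
  have h := hs.convexHull_inter (t₁ := Finset.image T.points {i}ᶜ)
    (t₂ := Finset.image T.points {j}ᶜ) (Finset.image_subset_image (Finset.subset_univ _))
    (Finset.image_subset_image (Finset.subset_univ _))
  simp only [Finset.coe_image, Finset.coe_compl, Finset.coe_singleton] at h
  rw [Set.range_comp, Set.range_comp, Fin.range_succAbove, Fin.range_succAbove, ← h,
    ← Set.image_inter T.independent.injective, ← Set.compl_union]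
  rfl

end Affine.Simplex

theorem surfaceArea_solidTetrahedron (T : Affine.Simplex ℝ (EuclideanSpace ℝ (Fin 3)) 3) :
    surfaceArea (solidTetrahedron T) =
      ∑ i : Fin 4, √(Matrix.gram ℝ fun k : Fin 2 =>
        T.points (i.succAbove k.succ) - T.points (i.succAbove 0)).det / 2 := by
  rw [surfaceArea, solidTetrahedron, T.frontier_convexHull (by simp), measure_iUnion₀]
  · simp_rw [euclideanHausdorffMeasure_convexHull_range]
    rw [tsum_fintype, ENNReal.toReal_sum fun _ _ => ENNReal.ofReal_ne_top]
    refine Finset.sum_congr rfl fun i _ => ?_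
    rw [ENNReal.toReal_ofReal (by positivity)]
    rfl
  · intro i j hij
    have hk : ∃ k l : Fin 4, ({i, j}ᶜ : Finset (Fin 4)) = {k, l} := by decide +revert
    obtain ⟨k, l, hkl⟩ := hk
    have hkl' : ({i, j}ᶜ : Set (Fin 4)) = {k, l} := by
      ext m
      simpa [not_or] using Finset.ext_iff.1 hkl m
    change _ = _
    rw [T.inter_convexHull_succAbove, hkl', Set.image_pair]
    exact euclideanHausdorffMeasure_two_convexHull_pair _ _
  · intro i
    exact ((Set.finite_range _).isCompact_convexHull (𝕜 := ℝ)).isClosed.measurableSet.nullMeasurableSet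

theorem bodyVolume_solidTetrahedron (T : Affine.Simplex ℝ (EuclideanSpace ℝ (Fin 3)) 3) :
    bodyVolume (solidTetrahedron T) =
      √(Matrix.gram ℝ fun k : Fin 3 => T.points k.succ - T.points 0).det / 6 := by
  rw [bodyVolume, solidTetrahedron, ← EuclideanSpace.euclideanHausdorffMeasure_eq_volume,
    euclideanHausdorffMeasure_convexHull_range, ENNReal.toReal_ofReal (by positivity)]
  norm_num [Nat.factorial]

/-! ### The algebraic inequality -/

open Matrix

theorem Matrix.PosSemidef.det_le_trace_div_three_pow {M : Matrix (Fin 3) (Fin 3) ℝ}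
    (hM : M.PosSemidef) : M.det ≤ (M.trace / 3) ^ 3 ∧
      (M.det = (M.trace / 3) ^ 3 → M = (M.trace / 3) • 1) := by
  have hdet : M.det = ∏ i, hM.1.eigenvalues i := hM.1.det_eq_prod_eigenvalues
  have htr : M.trace = ∑ i, hM.1.eigenvalues i := hM.1.trace_eq_sum_eigenvalues
  have hspec := hM.1.spectral_theorem
  have h0 := hM.eigenvalues_nonneg
  generalize hM.1.eigenvalues = e at hdet htr hspec h0
  rw [Fin.prod_univ_three] at hdet
  rw [Fin.sum_univ_three] at htr
  have hx := h0 0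
  have hy := h0 1
  have hz := h0 2
  have key : ((e 0 + e 1 + e 2) / 3) ^ 3 - e 0 * e 1 * e 2 =
      ((e 0 + e 1 + 7 * e 2) * (e 0 - e 1) ^ 2 + (e 1 + e 2 + 7 * e 0) * (e 1 - e 2) ^ 2 +
        (e 2 + e 0 + 7 * e 1) * (e 2 - e 0) ^ 2) / 54 := by ring
  refine ⟨?_, fun h => ?_⟩
  · rw [hdet, htr, ← sub_nonneg, key]
    positivity
  · rw [hdet, htr] at h
    rw [← sub_eq_zero, ← neg_eq_zero, neg_sub, key] at h
    have p1 : 0 ≤ (e 0 + e 1 + 7 * e 2) * (e 0 - e 1) ^ 2 := by positivity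
    have p2 : 0 ≤ (e 1 + e 2 + 7 * e 0) * (e 1 - e 2) ^ 2 := by positivity
    have p3 : 0 ≤ (e 2 + e 0 + 7 * e 1) * (e 2 - e 0) ^ 2 := by positivity
    have q1 : (e 0 + e 1 + 7 * e 2) * (e 0 - e 1) ^ 2 = 0 := by linarith
    have q2 : (e 1 + e 2 + 7 * e 0) * (e 1 - e 2) ^ 2 = 0 := by linarith
    -- If the coefficient vanishes, nonnegativity makes all three eigenvalues 0.
    have e01 : e 0 = e 1 := by
      rcases mul_eq_zero.1 q1 with h | h
      · linarith
      · linarith [pow_eq_zero_iff (two_ne_zero) |>.1 h]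
    have e12 : e 1 = e 2 := by
      rcases mul_eq_zero.1 q2 with h | h
      · linarith
      · linarith [pow_eq_zero_iff (two_ne_zero) |>.1 h]
    have hc : (e 0 + e 1 + e 2) / 3 = e 0 := by linarith
    have hd : diagonal (RCLike.ofReal ∘ e : Fin 3 → ℝ) = e 0 • (1 : Matrix (Fin 3) (Fin 3) ℝ) := by
      ext i j
      fin_cases i <;> fin_cases j <;> simp [e01, e12]
    rw [hd, map_smul, map_one] at hspec
    rw [htr, hc]
    exact hspec

theorem mul_le_sum_div_four_pow {x y z w : ℝ} (hx : 0 < x) (hy : 0 < y) (hz : 0 < z) (hw : 0 < w) :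
    x * y * z * w ≤ ((x + y + z + w) / 4) ^ 4 ∧
      (x * y * z * w = ((x + y + z + w) / 4) ^ 4 → x = y ∧ x = z ∧ x = w) := by
  have h1 : 0 ≤ ((x + y) / 2) ^ 2 - x * y := by nlinarith [sq_nonneg (x - y)]
  have h2 : 0 ≤ ((z + w) / 2) ^ 2 - z * w := by nlinarith [sq_nonneg (z - w)]
  have h3 : 0 ≤ ((x + y + z + w) / 4) ^ 2 - (x + y) / 2 * ((z + w) / 2) := by
    nlinarith [sq_nonneg (x + y - z - w)]
  -- The AM-GM defect splits into the two-variable defects for (x, y), (z, w) and their means.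
  have key : ((x + y + z + w) / 4) ^ 4 - x * y * z * w =
      (((x + y + z + w) / 4) ^ 2 - (x + y) / 2 * ((z + w) / 2)) *
        (((x + y + z + w) / 4) ^ 2 + (x + y) / 2 * ((z + w) / 2)) +
      (((x + y) / 2) ^ 2 - x * y) * ((z + w) / 2) ^ 2 +
      (((z + w) / 2) ^ 2 - z * w) * (x * y) := by ring
  have k1 := mul_nonneg h3 (by positivity :
    0 ≤ ((x + y + z + w) / 4) ^ 2 + (x + y) / 2 * ((z + w) / 2))
  have k2 := mul_nonneg h1 (by positivity : 0 ≤ ((z + w) / 2) ^ 2)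
  have k3 := mul_nonneg h2 (by positivity : 0 ≤ x * y)
  refine ⟨by linarith, fun h => ?_⟩
  rw [h, sub_self] at key
  have l1 : ((x + y + z + w) / 4) ^ 2 - (x + y) / 2 * ((z + w) / 2) = 0 :=
    (mul_eq_zero.1 (by linarith)).resolve_right
      (by positivity : ((x + y + z + w) / 4) ^ 2 + (x + y) / 2 * ((z + w) / 2) ≠ 0)
  have l2 : ((x + y) / 2) ^ 2 - x * y = 0 :=
    (mul_eq_zero.1 (by linarith)).resolve_right (by positivity : ((z + w) / 2) ^ 2 ≠ 0)
  have l3 : ((z + w) / 2) ^ 2 - z * w = 0 :=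
    (mul_eq_zero.1 (by linarith)).resolve_right (by positivity : x * y ≠ 0)
  have m1 : x + y - z - w = 0 := pow_eq_zero_iff two_ne_zero |>.1 (by linarith)
  have m2 : x - y = 0 := pow_eq_zero_iff two_ne_zero |>.1 (by linarith)
  have m3 : z - w = 0 := pow_eq_zero_iff two_ne_zero |>.1 (by linarith)
  exact ⟨by linarith, by linarith, by linarith⟩

/-- Cauchy–Binet: any three of the four vectors have the same determinant up to sign, leaving the
third elementary symmetric function of the weights. -/
theorem det_sum_smul_vecMulVec_self (x y z : Fin 3 → ℝ) (w₀ w₁ w₂ w₃ : ℝ) :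
    (w₀ • vecMulVec (x + y + z) (x + y + z) + w₁ • vecMulVec x x + w₂ • vecMulVec y y +
      w₃ • vecMulVec z z).det =
      (x ⬝ᵥ y ⨯₃ z) ^ 2 * (w₁ * w₂ * w₃ + w₀ * (w₁ * w₂ + w₁ * w₃ + w₂ * w₃)) := by
  simp [det_fin_three, vecMulVec_apply, crossProduct, dotProduct, Fin.sum_univ_three]
  ring

theorem dotProduct_sum_smul_vecMulVec_self_mulVec (x y z e : Fin 3 → ℝ) (w₀ w₁ w₂ w₃ : ℝ) :
    e ⬝ᵥ (w₀ • vecMulVec (x + y + z) (x + y + z) + w₁ • vecMulVec x x + w₂ • vecMulVec y y +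
      w₃ • vecMulVec z z) *ᵥ e =
      w₀ * (x ⬝ᵥ e + y ⬝ᵥ e + z ⬝ᵥ e) ^ 2 + w₁ * (x ⬝ᵥ e) ^ 2 + w₂ * (y ⬝ᵥ e) ^ 2 +
        w₃ * (z ⬝ᵥ e) ^ 2 := by
  simp [vecMulVec_apply, mulVec, dotProduct, Fin.sum_univ_three]
  ring

theorem cross_dot_cross_cross_cross (a b c : Fin 3 → ℝ) :
    (b ⨯₃ c) ⬝ᵥ (c ⨯₃ a) ⨯₃ (a ⨯₃ b) = (a ⬝ᵥ b ⨯₃ c) ^ 2 := by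
  simp [crossProduct, dotProduct, Fin.sum_univ_three]
  ring

theorem triple_product_pow_le {a b c : Fin 3 → ℝ} (hd : a ⬝ᵥ b ⨯₃ c ≠ 0) {s₀ s₁ s₂ s₃ : ℝ}
    (hs₀ : 0 ≤ s₀) (hs₁ : 0 ≤ s₁) (hs₂ : 0 ≤ s₂) (hs₃ : 0 ≤ s₃)
    (h₀ : s₀ ^ 2 = (b ⨯₃ c + c ⨯₃ a + a ⨯₃ b) ⬝ᵥ (b ⨯₃ c + c ⨯₃ a + a ⨯₃ b))
    (h₁ : s₁ ^ 2 = (b ⨯₃ c) ⬝ᵥ (b ⨯₃ c)) (h₂ : s₂ ^ 2 = (c ⨯₃ a) ⬝ᵥ (c ⨯₃ a))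
    (h₃ : s₃ ^ 2 = (a ⨯₃ b) ⬝ᵥ (a ⨯₃ b)) :
    6912 * (a ⬝ᵥ b ⨯₃ c) ^ 4 ≤ (s₀ + s₁ + s₂ + s₃) ^ 6 ∧
      (6912 * (a ⬝ᵥ b ⨯₃ c) ^ 4 = (s₀ + s₁ + s₂ + s₃) ^ 6 →
        b ⬝ᵥ b = a ⬝ᵥ a ∧ c ⬝ᵥ c = a ⬝ᵥ a ∧ (b - a) ⬝ᵥ (b - a) = a ⬝ᵥ a ∧
          (c - a) ⬝ᵥ (c - a) = a ⬝ᵥ a ∧ (c - b) ⬝ᵥ (c - b) = a ⬝ᵥ a) := by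
  set d := a ⬝ᵥ b ⨯₃ c with hd_def
  set x := b ⨯₃ c with hx
  set y := c ⨯₃ a with hy
  set z := a ⨯₃ b with hz
  have xa : x ⬝ᵥ a = d := by rw [dotProduct_comm]
  have xb : x ⬝ᵥ b = 0 := by rw [dotProduct_comm, hx, dot_self_cross]
  have xc : x ⬝ᵥ c = 0 := by rw [dotProduct_comm, hx, dot_cross_self]
  have yb : y ⬝ᵥ b = d := by
    rw [dotProduct_comm, hy, triple_product_permutation, triple_product_permutation]
  have yc : y ⬝ᵥ c = 0 := by rw [dotProduct_comm, hy, dot_self_cross]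
  have ya : y ⬝ᵥ a = 0 := by rw [dotProduct_comm, hy, dot_cross_self]
  have zc : z ⬝ᵥ c = d := by rw [dotProduct_comm, hz, triple_product_permutation]
  have za : z ⬝ᵥ a = 0 := by rw [dotProduct_comm, hz, dot_self_cross]
  have zb : z ⬝ᵥ b = 0 := by rw [dotProduct_comm, hz, dot_cross_self]
  have hpos {s : ℝ} {u e : Fin 3 → ℝ} (hs : 0 ≤ s) (h : s ^ 2 = u ⬝ᵥ u) (hu : u ⬝ᵥ e = d) :
      0 < s := by
    refine hs.lt_of_ne' fun h0 => hd ?_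
    rw [h0, zero_pow two_ne_zero, eq_comm, dotProduct_self_eq_zero] at h
    rw [← hu, h, zero_dotProduct]
  replace hs₀ := hpos (e := a) hs₀ h₀ (by simp [xa, ya, za])
  replace hs₁ := hpos hs₁ h₁ xa
  replace hs₂ := hpos hs₂ h₂ yb
  replace hs₃ := hpos hs₃ h₃ zc
  set M := s₀⁻¹ • vecMulVec (x + y + z) (x + y + z) + s₁⁻¹ • vecMulVec x x +
    s₂⁻¹ • vecMulVec y y + s₃⁻¹ • vecMulVec z z with hM_def
  have hterm {s : ℝ} (hs : 0 < s) (u : Fin 3 → ℝ) : (s⁻¹ • vecMulVec u u).PosSemidef := by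
    have := posSemidef_vecMulVec_self_star u
    rw [star_trivial] at this
    exact this.smul (inv_nonneg.2 hs.le)
  have hM : M.PosSemidef :=
    (((hterm hs₀ _).add (hterm hs₁ _)).add (hterm hs₂ _)).add (hterm hs₃ _)
  have htr : M.trace = s₀ + s₁ + s₂ + s₃ := by
    simp only [hM_def, trace_add, trace_smul, trace_vecMulVec, ← h₀, ← h₁, ← h₂, ← h₃, smul_eq_mul]
    field_simp
  have hdet : M.det * (s₀ * s₁ * s₂ * s₃) = d ^ 4 * (s₀ + s₁ + s₂ + s₃) := by
    rw [hM_def, det_sum_smul_vecMulVec_self, cross_dot_cross_cross_cross]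
    field_simp
    ring
  obtain ⟨hle, heq⟩ := hM.det_le_trace_div_three_pow
  obtain ⟨hle', heq'⟩ := mul_le_sum_div_four_pow hs₀ hs₁ hs₂ hs₃
  rw [htr] at hle heq
  set σ := s₀ + s₁ + s₂ + s₃
  set π := s₀ * s₁ * s₂ * s₃
  have hσ : 0 < σ := by positivity
  have hπ : 0 < π := by positivity
  -- Multiply det M ≤ (σ/3)³ by π and cancel σ.
  have hle₁ : 27 * d ^ 4 ≤ σ ^ 2 * π := by
    have := mul_le_mul_of_nonneg_right hle hπ.le
    rw [hdet] at this
    refine le_of_mul_le_mul_right (a := σ) ?_ hσ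
    linarith
  have hle₂ : σ ^ 2 * π ≤ σ ^ 2 * (σ / 4) ^ 4 := by gcongr
  refine ⟨by linarith, fun h => ?_⟩
  have hπ' : π = (σ / 4) ^ 4 := mul_left_cancel₀ (pow_ne_zero 2 hσ.ne') (by linarith)
  obtain ⟨e₁, e₂, e₃⟩ := heq' hπ'
  have hM' := heq (mul_right_cancel₀ hπ.ne' (by rw [hdet, hπ']; linear_combination σ * h / 6912))
  have hquad (e : Fin 3 → ℝ) := dotProduct_sum_smul_vecMulVec_self_mulVec x y z e s₀⁻¹ s₁⁻¹ s₂⁻¹ s₃⁻¹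
  simp_rw [← hM_def, hM', ← e₁, ← e₂, ← e₃, smul_mulVec, one_mulVec, dotProduct_smul,
    smul_eq_mul] at hquad
  have hedge {e : Fin 3 → ℝ} (he : σ / 3 * (e ⬝ᵥ e) = 2 * s₀⁻¹ * d ^ 2) :
      e ⬝ᵥ e = 2 * s₀⁻¹ * d ^ 2 / (σ / 3) := by
    rw [eq_div_iff (by positivity), mul_comm, he]
  have ha := hedge (e := a) (by rw [hquad]; simp only [xa, ya, za]; ring)
  have hb := hedge (e := b) (by rw [hquad]; simp only [xb, yb, zb]; ring)
  have hc := hedge (e := c) (by rw [hquad]; simp only [xc, yc, zc]; ring)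
  have hab := hedge (e := b - a) (by
    rw [hquad]; simp only [dotProduct_sub, xa, ya, za, xb, yb, zb]; ring)
  have hac := hedge (e := c - a) (by
    rw [hquad]; simp only [dotProduct_sub, xa, ya, za, xc, yc, zc]; ring)
  have hbc := hedge (e := c - b) (by
    rw [hquad]; simp only [dotProduct_sub, xb, yb, zb, xc, yc, zc]; ring)
  exact ⟨hb.trans ha.symm, hc.trans ha.symm, hab.trans ha.symm, hac.trans ha.symm,
    hbc.trans ha.symm⟩

/-! ### From equal edges to regularity -/

theorem Affine.Simplex.Equilateral.regular {V : Type*} [NormedAddCommGroup V]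
    [InnerProductSpace ℝ V] [FiniteDimensional ℝ V] {n : ℕ} {T : Affine.Simplex ℝ V n}
    (hn : Module.finrank ℝ V = n) (hT : T.Equilateral) : T.Regular := by
  intro σ
  have hd (i j) : dist (T.points (σ i)) (T.points (σ j)) = dist (T.points i) (T.points j) := by
    by_cases hij : i = j
    · simp [hij]
    · exact hT.dist_eq (σ.injective.ne hij) hij
  let b := (T.toAffineBasis hn).basisOf 0
  let f : V →ₗ[ℝ] V := b.constr ℝ fun i => T.points (σ i) - T.points (σ 0)
  have hb (i) : b i = T.points i - T.points 0 := (T.toAffineBasis hn).basisOf_apply 0 i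
  have hfb (i) : f (b i) = T.points (σ i) - T.points (σ 0) := b.constr_basis ℝ _ i
  -- By polarization, inner products of edge vectors depend only on vertex distances, which σ
  -- preserves.
  have hf : (innerₗ V).compl₁₂ f f = innerₗ V := by
    refine LinearMap.ext_basis b b fun i j => ?_
    rw [LinearMap.compl₁₂_apply, hfb, hfb, hb, hb]
    simp only [innerₗ_apply_apply,
      real_inner_eq_norm_mul_self_add_norm_mul_self_sub_norm_sub_mul_self_div_two,
      sub_sub_sub_cancel_right, ← dist_eq_norm, hd]
  let g : V ≃ₗᵢ[ℝ] V :=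
    (f.isometryOfInner fun x y => LinearMap.congr_fun₂ hf x y).toLinearIsometryEquiv rfl
  refine ⟨((IsometryEquiv.subRight (T.points 0)).trans g.toIsometryEquiv).trans
    (IsometryEquiv.addRight (T.points (σ 0))), funext fun i => ?_⟩
  by_cases hi : i = 0
  · simp [hi]
  · have := hfb ⟨i, hi⟩
    rw [hb] at this
    change T.points (σ i) = f (T.points i - T.points 0) + T.points (σ 0)
    rw [this, sub_add_cancel]

/-! ### Passage to coordinates and conclusion -/

theorem gram_det_fin_two_ofLp (v : Fin 2 → EuclideanSpace ℝ (Fin 3)) :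
    (gram ℝ v).det = ((v 0).ofLp ⨯₃ (v 1).ofLp) ⬝ᵥ ((v 0).ofLp ⨯₃ (v 1).ofLp) := by
  simp only [det_fin_two, gram_apply, EuclideanSpace.inner_eq_star_dotProduct, star_trivial]
  simp [Fin.sum_univ_three, crossProduct, dotProduct]
  ring

theorem gram_det_fin_three_ofLp (v : Fin 3 → EuclideanSpace ℝ (Fin 3)) :
    (gram ℝ v).det = ((v 0).ofLp ⬝ᵥ (v 1).ofLp ⨯₃ (v 2).ofLp) ^ 2 := by
  simp only [det_fin_three, gram_apply, EuclideanSpace.inner_eq_star_dotProduct, star_trivial]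
  simp [Fin.sum_univ_three, crossProduct, dotProduct]
  ring

/-- The square of the triple product is the Gram determinant. -/
theorem triple_product_sq (a b c : Fin 3 → ℝ) :
    (a ⬝ᵥ b ⨯₃ c) ^ 2 = (a ⬝ᵥ a) * (b ⬝ᵥ b) * (c ⬝ᵥ c) + 2 * (a ⬝ᵥ b) * (b ⬝ᵥ c) * (a ⬝ᵥ c) -
      (a ⬝ᵥ a) * (b ⬝ᵥ c) ^ 2 - (b ⬝ᵥ b) * (a ⬝ᵥ c) ^ 2 - (c ⬝ᵥ c) * (a ⬝ᵥ b) ^ 2 := by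
  simp [crossProduct, dotProduct, Fin.sum_univ_three]
  ring

/-- The isoperimetric inequality for tetrahedra, in polynomial form. -/
theorem bodyVolume_pow_le_surfaceArea_pow (T : Affine.Simplex ℝ (EuclideanSpace ℝ (Fin 3)) 3) :
    0 < bodyVolume (solidTetrahedron T) ∧
    139968 * bodyVolume (solidTetrahedron T) ^ 4 ≤ surfaceArea (solidTetrahedron T) ^ 6 ∧
      (139968 * bodyVolume (solidTetrahedron T) ^ 4 = surfaceArea (solidTetrahedron T) ^ 6 ↔
        T.Equilateral) := by
  set a := (T.points 1 - T.points 0).ofLp with ha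
  set b := (T.points 2 - T.points 0).ofLp with hb
  set c := (T.points 3 - T.points 0).ofLp with hc
  have hV : bodyVolume (solidTetrahedron T) = |a ⬝ᵥ b ⨯₃ c| / 6 := by
    rw [bodyVolume_solidTetrahedron, gram_det_fin_three_ofLp, Real.sqrt_sq_eq_abs]
    rfl
  have hS : surfaceArea (solidTetrahedron T) =
      (√((b ⨯₃ c + c ⨯₃ a + a ⨯₃ b) ⬝ᵥ (b ⨯₃ c + c ⨯₃ a + a ⨯₃ b)) +
        √((b ⨯₃ c) ⬝ᵥ (b ⨯₃ c)) + √((c ⨯₃ a) ⬝ᵥ (c ⨯₃ a)) + √((a ⨯₃ b) ⬝ᵥ (a ⨯₃ b))) / 2 := by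
    have h₀ : (T.points 2 - T.points 1).ofLp ⨯₃ (T.points 3 - T.points 1).ofLp =
        b ⨯₃ c + c ⨯₃ a + a ⨯₃ b := by
      have h₂₁ : (T.points 2 - T.points 1).ofLp = b - a := by simp [ha, hb]
      have h₃₁ : (T.points 3 - T.points 1).ofLp = c - a := by simp [ha, hc]
      rw [h₂₁, h₃₁]
      simp only [map_sub, LinearMap.sub_apply, cross_self, ← cross_anticomm a c,
        ← cross_anticomm a b]
      abel
    have h₂ : (a ⨯₃ c) ⬝ᵥ (a ⨯₃ c) = (c ⨯₃ a) ⬝ᵥ (c ⨯₃ a) := by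
      rw [← cross_anticomm a c, neg_dotProduct_neg]
    rw [surfaceArea_solidTetrahedron, Fin.sum_univ_four, ← h₀, ← h₂]
    simp_rw [gram_det_fin_two_ofLp]
    simp only [← add_div]
    rfl
  have hd : a ⬝ᵥ b ⨯₃ c ≠ 0 := by
    have hli : LinearIndependent ℝ fun k : Fin 3 => T.points k.succ - T.points 0 :=
      ((affineIndependent_iff_linearIndependent_vsub ℝ _ 0).1 T.independent).comp
        (fun k : Fin 3 => ⟨k.succ, k.succ_ne_zero⟩) fun i j h => by simpa using h
    have h := (posDef_gram_of_linearIndependent hli).det_pos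
    rw [gram_det_fin_three_ofLp] at h
    exact pow_ne_zero_iff two_ne_zero |>.1 h.ne'
  have hnn (x : Fin 3 → ℝ) : √(x ⬝ᵥ x) ^ 2 = x ⬝ᵥ x := by
    refine Real.sq_sqrt ?_
    simpa using dotProduct_star_self_nonneg x
  obtain ⟨hle, heq⟩ := triple_product_pow_le hd (Real.sqrt_nonneg _) (Real.sqrt_nonneg _)
    (Real.sqrt_nonneg _) (Real.sqrt_nonneg _) (hnn _) (hnn _) (hnn _) (hnn _)
  -- 139968 = (216√3)² = 6912·6⁴/2⁶, from V = |d|/6 and S = σ/2.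
  have hV4 : 139968 * bodyVolume (solidTetrahedron T) ^ 4 =
      6912 * (a ⬝ᵥ b ⨯₃ c) ^ 4 / 64 := by
    rw [hV, div_pow, Even.pow_abs (by decide)]
    ring
  have hdist {i j : Fin 4} {x : Fin 3 → ℝ} (h : (T.points i - T.points j).ofLp = x) :
      dist (T.points i) (T.points j) ^ 2 = x ⬝ᵥ x := by
    rw [dist_eq_norm, EuclideanSpace.norm_sq_eq, h]
    simp [dotProduct, pow_two]
  have d₁₀ := hdist ha.symm
  have d₂₀ := hdist hb.symm
  have d₃₀ := hdist hc.symm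
  have d₂₁ := hdist (i := 2) (j := 1) (x := b - a) (by simp [ha, hb])
  have d₃₁ := hdist (i := 3) (j := 1) (x := c - a) (by simp [ha, hc])
  have d₃₂ := hdist (i := 3) (j := 2) (x := c - b) (by simp [hb, hc])
  refine ⟨by rw [hV]; positivity, ?_, ?_⟩
  · rw [hV4, hS, div_pow]
    rw [show (2 : ℝ) ^ 6 = 64 by norm_num]
    gcongr
  · rw [hV4, hS, div_pow]
    rw [show (2 : ℝ) ^ 6 = 64 by norm_num, div_left_inj' (by norm_num)]
    refine ⟨fun h => ?_, fun ⟨r, hr⟩ => ?_⟩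
    · obtain ⟨hbb, hcc, hba, hca, hcb⟩ := heq h
      rw [← d₁₀] at hbb hcc hba hca hcb
      rw [hbb, sq_eq_sq₀ dist_nonneg dist_nonneg] at d₂₀
      rw [hcc, sq_eq_sq₀ dist_nonneg dist_nonneg] at d₃₀
      rw [hba, sq_eq_sq₀ dist_nonneg dist_nonneg] at d₂₁
      rw [hca, sq_eq_sq₀ dist_nonneg dist_nonneg] at d₃₁
      rw [hcb, sq_eq_sq₀ dist_nonneg dist_nonneg] at d₃₂
      refine ⟨dist (T.points 1) (T.points 0), fun i j hij => ?_⟩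
      wlog hlt : j < i generalizing i j
      · rw [dist_comm]
        exact this j i hij.symm (lt_of_le_of_ne (not_lt.1 hlt) hij)
      fin_cases i <;> fin_cases j <;> first | rfl | assumption | exact absurd hlt (by decide)
    · rw [hr _ _ (by decide)] at d₁₀ d₂₀ d₃₀ d₂₁ d₃₁ d₃₂
      have hab : a ⬝ᵥ b = r ^ 2 / 2 := by
        simp only [dotProduct_sub, sub_dotProduct, dotProduct_comm b a] at d₂₁
        linarith
      have hac : a ⬝ᵥ c = r ^ 2 / 2 := by
        simp only [dotProduct_sub, sub_dotProduct, dotProduct_comm c a] at d₃₁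
        linarith
      have hbc : b ⬝ᵥ c = r ^ 2 / 2 := by
        simp only [dotProduct_sub, sub_dotProduct, dotProduct_comm c b] at d₃₂
        linarith
      have hba : b ⬝ᵥ a = r ^ 2 / 2 := dotProduct_comm b a ▸ hab
      have hca : c ⬝ᵥ a = r ^ 2 / 2 := dotProduct_comm c a ▸ hac
      have hcb : c ⬝ᵥ b = r ^ 2 / 2 := dotProduct_comm c b ▸ hbc
      have hsqrt : √(3 / 4 * r ^ 4) = √3 / 2 * r ^ 2 := by
        rw [Real.sqrt_eq_iff_mul_self_eq (by positivity) (by positivity)]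
        have := Real.mul_self_sqrt (show (0 : ℝ) ≤ 3 by norm_num)
        linear_combination -r ^ 4 / 4 * this
      have h3 : √3 ^ 6 = 27 := by
        rw [show 6 = 2 * 3 from rfl, pow_mul, Real.sq_sqrt (by norm_num)]
        norm_num
      have hdd : (a ⬝ᵥ b ⨯₃ c) ^ 2 = r ^ 6 / 2 := by
        rw [triple_product_sq, ← d₁₀, ← d₂₀, ← d₃₀, hab, hac, hbc]
        ring
      have hdd' : (a ⬝ᵥ b ⨯₃ c) ^ 4 = r ^ 12 / 4 := by
        rw [show 4 = 2 * 2 from rfl, pow_mul, hdd]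
        ring
      have s₁ : (b ⨯₃ c) ⬝ᵥ (b ⨯₃ c) = 3 / 4 * r ^ 4 := by
        rw [cross_dot_cross, hbc, hcb, ← d₂₀, ← d₃₀]; ring
      have s₂ : (c ⨯₃ a) ⬝ᵥ (c ⨯₃ a) = 3 / 4 * r ^ 4 := by
        rw [cross_dot_cross, hac, hca, ← d₁₀, ← d₃₀]; ring
      have s₃ : (a ⨯₃ b) ⬝ᵥ (a ⨯₃ b) = 3 / 4 * r ^ 4 := by
        rw [cross_dot_cross, hab, hba, ← d₁₀, ← d₂₀]; ring
      have s₀ : (b ⨯₃ c + c ⨯₃ a + a ⨯₃ b) ⬝ᵥ (b ⨯₃ c + c ⨯₃ a + a ⨯₃ b) = 3 / 4 * r ^ 4 := by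
        simp only [dotProduct_add, add_dotProduct, cross_dot_cross, hab, hba, hbc, hcb, hac, hca,
          ← d₁₀, ← d₂₀, ← d₃₀]
        ring
      rw [s₀, s₁, s₂, s₃, hsqrt, hdd']
      linear_combination -64 * r ^ 12 * h3

theorem mainTheorem4 (T : Affine.Simplex ℝ (EuclideanSpace ℝ (Fin 3)) 3) :
    surfaceArea (solidTetrahedron T) ^ 3 / bodyVolume (solidTetrahedron T) ^ 2
        ≥ 216 * Real.sqrt 3 ∧
      (surfaceArea (solidTetrahedron T) ^ 3 / bodyVolume (solidTetrahedron T) ^ 2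
          = 216 * Real.sqrt 3 ↔ T.Regular) := by
  obtain ⟨hV, hle, heq⟩ := bodyVolume_pow_le_surfaceArea_pow T
  have hS : 0 ≤ surfaceArea (solidTetrahedron T) := ENNReal.toReal_nonneg
  set S := surfaceArea (solidTetrahedron T)
  set V := bodyVolume (solidTetrahedron T)
  have h₀ : 0 ≤ 216 * √3 * V ^ 2 := by positivity
  have h₁ : 0 ≤ S ^ 3 := by positivity
  have hsq : (216 * √3 * V ^ 2) ^ 2 = 139968 * V ^ 4 := by
    rw [mul_pow, mul_pow, Real.sq_sqrt (by norm_num)]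
    ring
  have hsq' : (S ^ 3) ^ 2 = S ^ 6 := by ring
  refine ⟨?_, ?_⟩
  · rw [ge_iff_le, le_div_iff₀ (by positivity), ← sq_le_sq₀ h₀ h₁, hsq, hsq']
    exact hle
  · rw [div_eq_iff (by positivity), ← sq_eq_sq₀ h₁ h₀, hsq, hsq', eq_comm, heq]
    exact ⟨fun h => h.regular (by simp), fun h => h.equilateral⟩
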